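/- **Setting.** Let $A:[t_0,\infty)\to\mathbb R^{n\times n}$ and $B:[t_0,\infty)\to\mathbb R^{n\times m}$ be integrable on every compact interval of $[t_0,\infty)$, let $U\subset\mathbb R^m$ and $S\subset\mathbb R^n$ be convex, compact and nonempty, and let $t_f>t_0$. Let $\mathcal U$ be the set of measurable $u:[t_0,\infty)\to U$, and let $y(\cdot,y_0,u)$ be the absolutely continuous solution of $\dot y=A(t)y+B(t)u(t)$ a.e., $y(t_0)=y_0$. Put $$T(y_0)=\inf_{u\in\mathcal U}\inf\{t\ge t_0: y(t,y_0,u)\in S\}\in[t_0,\infty],\quad \mathcal R(t)=\{y_0: \exists u\in\mathcal U,\ y(t,y_0,u)\in S\},\quad \mathcal R=\bigcup_{t\ge t_0}\mathcal R(t),$$ and assume that $\mathcal R(t_1)\subset\operatorname{int}\mathcal R(t_2)$ whenever $t_0\le t_1<t_2\le t_f$. **Discrete reachable sets.** Let $K,N\ge1$ be integers, $\Delta t=(t_f-t_0)/K$, $h=\Delta t/N$, $t_i=t_0+i\Delta t$, $t_{ij}=t_i+jh$, and $\bar B(t)=-B(t_0+t_f-t)$. Let $c_0,\dots,c_N\ge0$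 be weights, and let $\Phi_h(t,s)\in\mathbb R^{n\times n}$ be given for $t,s$ in the grid $t_0+h\{0,\dots,KN\}$, with $\Phi_h(t,t_0)=\Phi_h(t,s)\Phi_h(s,t_0)$ for $s\le t$. Let $l^1,\dots,l^{N_{\mathcal R}}\in\mathbb R^n$ and $\eta^1,\dots,\eta^{N_U}\in\mathbb R^m$ be unit vectors. For a set $M$ let $y(l,M)$ denote an arbitrarily chosen maximizer of $\langle l,\cdot\rangle$ over $M$. Set $\widetilde U_\Delta=\{y(\eta^r,U)\}_r$, $Y_{h\Delta}(t_0)=\{y(l^k,S)\}_k$ and, for $i=0,\dots,K-1$, $$\widetilde{\mathcal R}_{h\Delta}(t_{i+1})=\operatorname{co}\Big(\Phi_h(t_{i+1},t_i)Y_{h\Delta}(t_i)+h\sum_{j=0}^N c_j\Phi_h(t_{i+1},t_{ij})\bar B(t_{ij})\widetilde U_\Delta\Big),\quad Y_{h\Delta}(t_{i+1})=\{y(l^k,\widetilde{\mathcal R}_{h\Delta}(t_{i+1}))\}_k .$$ Let $\mathcal R_{h\Delta}(t_i)=\operatorname{co}Y_{h\Delta}(t_i)$ for $i=0,\dots,K$,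 $S_\Delta=\mathcal R_{h\Delta}(t_0)$ and $\Omega=\bigcup_{i=0}^K\mathcal R_{h\Delta}(t_i)$. **Discrete minimum time function.** Let $\Gamma_1,\dots,\Gamma_M$ be $n$-simplices with $\Omega\setminus\operatorname{int}S\subset\bigcup_j\Gamma_j\subset\Omega$, any two different ones being disjoint or meeting in a common face, such that all vertices lie in $\bigcup_iY_{h\Delta}(t_i)$, each point of $\bigcup_iY_{h\Delta}(t_i)$ is a vertex of some $\Gamma_j$, and for each $j$ there is $i<K$ such that every vertex of $\Gamma_j$ lies in $\mathcal R_{h\Delta}(t_i)\cup\mathcal R_{h\Delta}(t_{i+1})$. Let $\Delta_\Gamma=\max_j\operatorname{diam}\Gamma_j$. Let $T_{h\Delta}$ be the function on $\Omega$ with $T_{h\Delta}=t_0$ on $S_\Delta$; $T_{h\Delta}(x)=t_i$ for $x\in\partial\mathcal R_{h\Delta}(t_i)\setminus S_\Delta$, $i=1,\dots,K$ (for one such $i$, if there are several); $T_{h\Delta}(x)=\sum_{\nu}\lambda_\nu T_{h\Delta}(x_\nu)$ at all other points $x=\sum_\nu\lambda_\nu x_\nu$ (with $\lambda_\nu\ge0$,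 $\sum_\nu\lambda_\nu=1$) of a simplex with vertices $x_1,\dots,x_{n+1}$; and $T_{h\Delta}=t_0$ at the remaining points of $\Omega$ (which lie in $\operatorname{int}S$). **Theorem 3.4.** Let $\omega:[0,\infty)\to\mathbb R$ be non-decreasing with $|T(x)-T(y)|\le\omega(\|x-y\|)$ for all $x,y\in\mathcal R$. Suppose that $\Omega\subset\mathcal R$ (so that $T$ is finite on $\Omega$) and that, for some real $C$ and $p$, $d_H(\mathcal R_{h\Delta}(t_i),\mathcal R(t_i))\le Ch^p$ for $i=0,\dots,K$, where $d_H$ is the Hausdorff distance. Then $$\|T-T_{h\Delta}\|_{\infty,\Omega}=\sup_{x\in\Omega}|T(x)-T_{h\Delta}(x)|\le\omega(\Delta_\Gamma)+\omega(Ch^p).$$ -/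

import Mathlib

open MeasureTheory Set
open scoped Pointwise ENNReal

/-- `ℝⁿ` with the Euclidean norm. -/
abbrev RSpace (n : ℕ) : Type := EuclideanSpace ℝ (Fin n)

/-- The data of the linear minimum time problem
`ẏ(t) = A(t) y(t) + B(t) u(t)`, `u(t) ∈ U`, with target set `S`, initial time `t₀` and maximal
time `tf`. The matrices `A(t) ∈ ℝⁿˣⁿ`, `B(t) ∈ ℝⁿˣᵐ` are given as linear maps. -/
structure ControlProblem (n m : ℕ) where
  A : ℝ → (RSpace n →L[ℝ] RSpace n)
  B : ℝ → (RSpace m →L[ℝ] RSpace n)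
  U : Set (RSpace m)
  S : Set (RSpace n)
  t₀ : ℝ
  tf : ℝ

namespace ControlProblem

variable {n m : ℕ} (P : ControlProblem n m)

/-- Admissible controls: measurable functions `[t₀, ∞) → U`. -/
def admissible : Set (ℝ → RSpace m) :=
  {u | Measurable u ∧ ∀ t, P.t₀ ≤ t → u t ∈ P.U}

/-- `y` is the (absolutely continuous) solution on `[t₀, t]` of `ẏ = A y + B u` a.e. with
`y(t₀) = y₀`, written as a Carathéodory solution of the integral equation. -/
def IsSolution (y₀ : RSpace n) (u : ℝ → RSpace m) (t : ℝ) (y : ℝ → RSpace n) : Prop :=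
  ContinuousOn y (Icc P.t₀ t) ∧
    ∀ s ∈ Icc P.t₀ t, y s = y₀ + ∫ r in P.t₀..s, (P.A r (y r) + P.B r (u r))

/-- `y(t, y₀, u) ∈ S`: the trajectory starting at `y₀` with control `u` is in the target at
time `t`. -/
def InTargetAt (y₀ : RSpace n) (u : ℝ → RSpace m) (t : ℝ) : Prop :=
  ∃ y : ℝ → RSpace n, P.IsSolution y₀ u t y ∧ y t ∈ P.S

/-- `t(y₀, u)`, the first time at which the trajectory hits the target (`⊤` if it never does). -/
noncomputable def hittingTime (y₀ : RSpace n) (u : ℝ → RSpace m) : EReal :=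
  sInf ((fun t : ℝ => (t : EReal)) '' {t | P.t₀ ≤ t ∧ P.InTargetAt y₀ u t})

/-- The minimum time function `T`, with values in `[t₀, ∞]`. -/
noncomputable def minTime (y₀ : RSpace n) : EReal :=
  ⨅ u ∈ P.admissible, P.hittingTime y₀ u

/-- The reachable set `R(t)` for fixed end time `t`. -/
def reach (t : ℝ) : Set (RSpace n) :=
  {y₀ | ∃ u ∈ P.admissible, P.InTargetAt y₀ u t}

/-- The reachable set `R` up to a finite time. -/
def reachAll : Set (RSpace n) := ⋃ t ∈ Ici P.t₀, P.reach t

/-- The standing assumptions (i)-(iv). -/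
structure StandingAssumptions : Prop where
  t₀_lt_tf : P.t₀ < P.tf
  integrable_A : ∀ t, P.t₀ ≤ t → IntegrableOn P.A (Icc P.t₀ t)
  integrable_B : ∀ t, P.t₀ ≤ t → IntegrableOn P.B (Icc P.t₀ t)
  convex_U : Convex ℝ P.U
  isCompact_U : IsCompact P.U
  nonempty_U : P.U.Nonempty
  convex_S : Convex ℝ P.S
  isCompact_S : IsCompact P.S
  nonempty_S : P.S.Nonempty
  strictly_expanding : ∀ t₁ t₂, P.t₀ ≤ t₁ → t₁ < t₂ → t₂ ≤ P.tf →
    P.reach t₁ ⊆ interior (P.reach t₂)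

/-- The matrix `B̄(t) = -B(t₀ + tf - t)` of the time-reversed system. -/
def Bbar (t : ℝ) : RSpace m →L[ℝ] RSpace n := -P.B (P.t₀ + P.tf - t)

end ControlProblem

/-- The supporting face `Y(l, A)` of `A` in direction `l`. -/
def supportingFace {n : ℕ} (l : RSpace n) (A : Set (RSpace n)) : Set (RSpace n) :=
  {x | x ∈ A ∧ ∀ z ∈ A, inner ℝ l z ≤ inner ℝ l x}

/-- The parameters of a set-valued combination method with discretized directions:
`K` coarse time intervals, each divided into `N` steps; `Φ k l` stands for `Φ_h(t₀ + k h, t₀ + l h)`,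
the approximate fundamental solution on the fine grid, with its semigroup property;
the quadrature weights `c j ≥ 0`, `j = 0, …, N`; finitely many normed directions in `ℝⁿ`, `ℝᵐ`. -/
structure DiscreteScheme (n m : ℕ) where
  K : ℕ
  N : ℕ
  K_pos : 0 < K
  N_pos : 0 < N
  Φ : ℕ → ℕ → (RSpace n →L[ℝ] RSpace n)
  Φ_semigroup : ∀ k l, k + l ≤ K * N → Φ (k + l) 0 = (Φ (k + l) k).comp (Φ k 0)
  c : ℕ → ℝ
  c_nonneg : ∀ j ≤ N, 0 ≤ c j
  numDirR : ℕ
  dirR : Fin numDirR → RSpace n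
  norm_dirR : ∀ k, ‖dirR k‖ = 1
  numDirU : ℕ
  dirU : Fin numDirU → RSpace m
  norm_dirU : ∀ r, ‖dirU r‖ = 1

namespace DiscreteScheme

variable {n m : ℕ} (D : DiscreteScheme n m) (P : ControlProblem n m)

/-- `Δt = (tf - t₀) / K`. -/
noncomputable def dt : ℝ := (P.tf - P.t₀) / D.K

/-- The step size `h = Δt / N`. -/
noncomputable def h : ℝ := D.dt P / D.N

/-- `tᵢ = t₀ + i Δt`. -/
noncomputable def time (i : ℕ) : ℝ := P.t₀ + i * D.dt P

/-- `tᵢⱼ = tᵢ + j h`. -/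
noncomputable def subTime (i j : ℕ) : ℝ := D.time P i + j * D.h P

/-- One step of the scheme, applied to the point sets `Y` (for `Y_{hΔ}(tᵢ)`) and `V` (for `Ũ_Δ`):
`Φ_h(tᵢ₊₁, tᵢ) Y + h ∑_{j=0}^N c_j Φ_h(tᵢ₊₁, tᵢⱼ) B̄(tᵢⱼ) V` (Minkowski sums). -/
noncomputable def step (i : ℕ) (Y : Set (RSpace n)) (V : Set (RSpace m)) : Set (RSpace n) :=
  D.Φ ((i + 1) * D.N) (i * D.N) '' Y +
    D.h P • ∑ j ∈ Finset.range (D.N + 1),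
      D.c j • ((D.Φ ((i + 1) * D.N) (i * D.N + j)).comp (P.Bbar (D.subTime P i j)) '' V)

end DiscreteScheme

/-- A run of the algorithm that computes the supporting points of the fully discrete reachable
sets. The supporting point in each direction is an arbitrary element of the supporting face:
`u r = y(ηʳ, U)`, `y 0 k = y(lᵏ, S)`, `y (i+1) k = y(lᵏ, R̃_{hΔ}(tᵢ₊₁))`. -/
structure AlgorithmRun {n m : ℕ} (P : ControlProblem n m) (D : DiscreteScheme n m) where
  u : Fin D.numDirU → RSpace m
  u_mem : ∀ r, u r ∈ supportingFace (D.dirU r) P.U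
  y : ℕ → Fin D.numDirR → RSpace n
  y_zero : ∀ k, y 0 k ∈ supportingFace (D.dirR k) P.S
  y_succ : ∀ i < D.K, ∀ k, y (i + 1) k ∈
    supportingFace (D.dirR k) (convexHull ℝ (D.step P i (range (y i)) (range u)))

namespace AlgorithmRun

variable {n m : ℕ} {P : ControlProblem n m} {D : DiscreteScheme n m} (Z : AlgorithmRun P D)

/-- `Y_{hΔ}(tᵢ)`. -/
def Y (i : ℕ) : Set (RSpace n) := range (Z.y i)

/-- The fully discrete reachable set `R_{hΔ}(tᵢ) = co Y_{hΔ}(tᵢ)`; for `i = 0` it is `S_Δ`. -/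
def R (i : ℕ) : Set (RSpace n) := convexHull ℝ (Z.Y i)

/-- The computational domain `Ω`, the union of `R_{hΔ}(tᵢ)`, `i = 0, …, K`. -/
def Ω : Set (RSpace n) := ⋃ i ∈ Iic D.K, Z.R i

end AlgorithmRun

/-- A simplicial triangulation over `Ω \ int S` with grid nodes in the sets `Y_{hΔ}(tᵢ)`.
As the nodes closest to the target lie in `S_Δ ⊆ S`, a curved boundary of `S` cannot be met
exactly; the covering condition admits a triangulation of `Ω \ int S`, one of `Ω \ int S_Δ`,
and everything in between. -/
structure Triangulation {n m : ℕ} {P : ControlProblem n m} {D : DiscreteScheme n m}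
    (Z : AlgorithmRun P D) where
  M : ℕ
  simplex : Fin M → Affine.Simplex ℝ (RSpace n) n
  /-- the simplices cover the domain outside the interior of the target -/
  covers : Z.Ω \ interior P.S ⊆ ⋃ j, convexHull ℝ (range (simplex j).points)
  subset_domain : (⋃ j, convexHull ℝ (range (simplex j).points)) ⊆ Z.Ω
  /-- two different simplices meet in a common face, or not at all -/
  inter_face : ∀ j j', j ≠ j' →
    convexHull ℝ (range (simplex j).points) ∩ convexHull ℝ (range (simplex j').points) =
      convexHull ℝ (range (simplex j).points ∩ range (simplex j').points)
  /-- the grid nodes are supporting points -/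
  nodes : ∀ j ν, ∃ i ≤ D.K, (simplex j).points ν ∈ Z.Y i
  /-- every supporting point is a vertex of some simplex -/
  supporting_points : ∀ i ≤ D.K, ∀ x ∈ Z.Y i, ∃ j ν, (simplex j).points ν = x
  /-- the vertices of a simplex belong to two consecutive discrete reachable sets -/
  layers : ∀ j, ∃ i < D.K, ∀ ν, (simplex j).points ν ∈ Z.R i ∪ Z.R (i + 1)

namespace Triangulation

variable {n m : ℕ} {P : ControlProblem n m} {D : DiscreteScheme n m} {Z : AlgorithmRun P D}
  (G : Triangulation Z)

/-- The closed simplex `Γⱼ`. -/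
def cell (j : Fin G.M) : Set (RSpace n) := convexHull ℝ (range (G.simplex j).points)

/-- The maximal diameter `Δ_Γ` of the simplices. -/
noncomputable def maxDiam : ℝ := ⨆ j, Metric.diam (G.cell j)

end Triangulation

/-- `x` lies on the boundary of one of the sets `R_{hΔ}(tᵢ)`, `i = 1, …, K`. -/
def AlgorithmRun.OnBoundary {n m : ℕ} {P : ControlProblem n m} {D : DiscreteScheme n m}
    (Z : AlgorithmRun P D) (x : RSpace n) : Prop :=
  ∃ i, 1 ≤ i ∧ i ≤ D.K ∧ x ∈ frontier (Z.R i)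

/-- `T` is the fully discrete minimum time function `T_{hΔ}` on `Ω`: it is `t₀` on `S_Δ`, `tᵢ` on
the boundary of `R_{hΔ}(tᵢ)`, and at all other points it is interpolated linearly on the simplices.
If a point is on the boundary of several `R_{hΔ}(tᵢ)` (impossible when these sets are strictly
nested), any of the times `tᵢ` is allowed. Points of the target that no simplex contains
get the value `t₀`. -/
structure IsDiscreteMinTime {n m : ℕ} {P : ControlProblem n m} {D : DiscreteScheme n m}
    {Z : AlgorithmRun P D} (G : Triangulation Z) (T : RSpace n → ℝ) : Prop where
  on_target : ∀ x ∈ Z.R 0, T x = P.t₀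
  on_boundary : ∀ x ∉ Z.R 0, Z.OnBoundary x →
    ∃ i, 1 ≤ i ∧ i ≤ D.K ∧ x ∈ frontier (Z.R i) ∧ T x = D.time P i
  on_simplex : ∀ x ∈ Z.Ω, x ∉ Z.R 0 → ¬ Z.OnBoundary x →
    ∀ (j : Fin G.M) (w : Fin (n + 1) → ℝ), (∀ ν, 0 ≤ w ν) → ∑ ν, w ν = 1 →
      x = ∑ ν, w ν • (G.simplex j).points ν →
      T x = ∑ ν, w ν * T ((G.simplex j).points ν)
  on_rest : ∀ x ∈ Z.Ω, x ∉ Z.R 0 → ¬ Z.OnBoundary x → x ∈ P.S →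
    (∀ j, x ∉ G.cell j) → T x = P.t₀

/-- The supremum norm of `f` over `Ω`, with values in `[0, ∞]`. -/
noncomputable def supNormOn {n : ℕ} (Ω : Set (RSpace n)) (f : RSpace n → ℝ) : ℝ≥0∞ :=
  ⨆ x ∈ Ω, ‖f x‖ₑ

/-! The estimate rests on one fact about `T`: it equals `t` on the boundary of `P.reach t`. Such a
point lies in the closed set `P.reach t`, and hitting the target at some `s < t` would put it in the
interior by strict expansion. A boundary point of the compact convex set `Z.R i` has, within the
Hausdorff distance, a boundary point of `P.reach (D.time P i)`. So the modulus of `T` bounds the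
error there by `ω(C h^p)`. Every grid node is a supporting point, so it lies on such a boundary or
in `Z.R 0 ⊆ P.S`, where both functions are `t₀`. At an interpolated point `x`, passing from `x` to a
vertex costs `ω(Δ_Γ)` and the error at the vertex `ω(C h^p)`; a convex combination of the vertex
values inherits the bound. A point of `Ω` outside all simplices lies in the target.

Most of the work is the compactness of `P.reach t`. The state equation, read backward from the end
time, is a Volterra equation `(1 - V) y = z + ∫ B u` with `1 - V` invertible. Hence the initial
value is an affine function of the end point `z ∈ S` and the control `u`. The controls form a closed
bounded convex subset of `L²`; minimal-norm elements (`isClosed_image_of_affineOn`) replace weak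
compactness in showing that their image is closed. -/

/-! ### Closed affine images and boundary points of convex sets -/

/-- The image of a bounded closed convex set of a Hilbert space under a map that is affine and
continuous on it is closed. -/
theorem isClosed_image_of_affineOn {H F : Type*} [NormedAddCommGroup H] [InnerProductSpace ℝ H]
    [CompleteSpace H] [NormedAddCommGroup F] [NormedSpace ℝ F] {C : Set H} (hC : IsClosed C)
    (hconv : Convex ℝ C) (hb : Bornology.IsBounded C) {f : H → F} (hf : ContinuousOn f C)
    (haff : ∀ x ∈ C, ∀ y ∈ C, ∀ a b : ℝ, 0 ≤ a → 0 ≤ b → a + b = 1 →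
      f (a • x + b • y) = a • f x + b • f y) : IsClosed (f '' C) := by
  refine isClosed_of_closure_subset fun z hz => ?_
  let D : ℕ → Set H := fun k => C ∩ f ⁻¹' Metric.closedBall z (1 / ((k : ℝ) + 1))
  have hDclosed : ∀ k, IsClosed (D k) := fun k =>
    hf.preimage_isClosed_of_isClosed hC Metric.isClosed_closedBall
  have hDconv : ∀ k, Convex ℝ (D k) := by
    intro k x hx y hy a b ha hb' hab
    refine ⟨hconv hx.1 hy.1 ha hb' hab, ?_⟩
    have := convex_closedBall z (1 / ((k : ℝ) + 1)) hx.2 hy.2 ha hb' hab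
    rwa [mem_preimage, haff x hx.1 y hy.1 a b ha hb' hab]
  have hDne : ∀ k, (D k).Nonempty := by
    intro k
    obtain ⟨_, ⟨x, hx, rfl⟩, hxz⟩ := Metric.mem_closure_iff.1 hz (1 / ((k : ℝ) + 1))
      (by positivity)
    exact ⟨x, hx, by rw [mem_preimage, Metric.mem_closedBall, dist_comm]; exact hxz.le⟩
  have hDanti : ∀ k l, k ≤ l → D l ⊆ D k := by
    intro k l hkl x hx
    refine ⟨hx.1, Metric.closedBall_subset_closedBall ?_ hx.2⟩
    gcongr
  -- The element `v` of minimal norm satisfies `⟪v, w - v⟫ ≥ 0`. The inequality makes `v` a Cauchy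
  -- sequence: the sets `D k` decrease, so the squared norms increase, and they are bounded.
  have hmin : ∀ k, ∃ v ∈ D k, ∀ w ∈ D k, ‖w - v‖ ^ 2 ≤ ‖w‖ ^ 2 - ‖v‖ ^ 2 := by
    intro k
    obtain ⟨v, hv, hv'⟩ := exists_norm_eq_iInf_of_complete_convex (hDne k)
      (hDclosed k).isComplete (hDconv k) 0
    refine ⟨v, hv, fun w hw => ?_⟩
    have h1 := (norm_eq_iInf_iff_real_inner_le_zero (hDconv k) hv).1 hv' w hw
    have h2 := norm_add_sq_real v (w - v)
    rw [zero_sub, inner_neg_left] at h1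
    rw [add_sub_cancel] at h2
    linarith
  choose v hvD hv using hmin
  obtain ⟨R, hR⟩ := hb.exists_norm_le
  have hmono : Monotone fun k => ‖v k‖ ^ 2 := by
    intro k l hkl
    have := hv k (v l) (hDanti k l hkl (hvD l))
    have h0 := sq_nonneg ‖v l - v k‖
    simp only
    linarith
  have hbdd : BddAbove (range fun k => ‖v k‖ ^ 2) := by
    refine ⟨R ^ 2, ?_⟩
    rintro _ ⟨k, rfl⟩
    exact pow_le_pow_left₀ (norm_nonneg _) (hR _ (hvD k).1) 2
  have hs : CauchySeq fun k => ‖v k‖ ^ 2 :=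
    (tendsto_atTop_ciSup hmono hbdd).cauchySeq
  have hvc : CauchySeq v := by
    rw [Metric.cauchySeq_iff'] at hs ⊢
    intro ε hε
    obtain ⟨N, hN⟩ := hs (ε ^ 2) (by positivity)
    refine ⟨N, fun k hk => ?_⟩
    have h1 := hv N (v k) (hDanti N k hk (hvD k))
    have h2 := hN k hk
    rw [Real.dist_eq] at h2
    rw [dist_eq_norm]
    exact lt_of_pow_lt_pow_left₀ 2 hε.le (h1.trans_lt ((le_abs_self _).trans_lt h2))
  obtain ⟨x, hx⟩ := cauchySeq_tendsto_of_complete hvc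
  have hxD : ∀ k, x ∈ D k := fun k => (hDclosed k).mem_of_tendsto hx
    (Filter.eventually_atTop.2 ⟨k, fun l hl => hDanti k l hl (hvD l)⟩)
  refine ⟨x, (hxD 0).1, ?_⟩
  rw [← dist_le_zero]
  exact ge_of_tendsto' tendsto_one_div_add_atTop_nhds_zero_nat fun k => (hxD k).2

/-- A closed convex set in a finite-dimensional space has a supporting hyperplane at every
frontier point. -/
theorem exists_norm_eq_one_inner_le_of_mem_frontier {E : Type*} [NormedAddCommGroup E]
    [InnerProductSpace ℝ E] [FiniteDimensional ℝ E] {A : Set E} (hA : IsClosed A)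
    (hconv : Convex ℝ A) {x : E} (hx : x ∈ frontier A) :
    ∃ l : E, ‖l‖ = 1 ∧ ∀ a ∈ A, inner ℝ l a ≤ inner ℝ l x := by
  have hxA : x ∈ A := hA.frontier_subset hx
  rw [frontier_eq_closure_inter_closure] at hx
  obtain ⟨q, hq, hqx⟩ := mem_closure_iff_seq_limit.1 hx.2
  -- Points `q k` outside `A` converge to `x`. Normalizing `q k` minus its projection gives unit
  -- normals, and a limit of these on the compact sphere supports `A` at `x`, even if `A` has empty
  -- interior.
  have key : ∀ k, ∃ l : E, l ∈ Metric.sphere (0 : E) 1 ∧ ∀ a ∈ A, inner ℝ l a ≤ inner ℝ l (q k) := by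
    intro k
    obtain ⟨v, hv, hv'⟩ := exists_norm_eq_iInf_of_complete_convex ⟨x, hxA⟩ hA.isComplete hconv (q k)
    have h1 := (norm_eq_iInf_iff_real_inner_le_zero hconv hv).1 hv'
    have hne : q k - v ≠ 0 := fun h => hq k (by rwa [sub_eq_zero.1 h])
    refine ⟨‖q k - v‖⁻¹ • (q k - v), by simp [norm_smul, hne], fun a ha => ?_⟩
    rw [real_inner_smul_left, real_inner_smul_left]
    refine mul_le_mul_of_nonneg_left ?_ (by positivity)
    have h2 := h1 a ha
    have h3 : 0 ≤ inner ℝ (q k - v) (q k - v) := real_inner_self_nonneg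
    rw [inner_sub_right] at h2 h3
    linarith
  choose l hl hla using key
  obtain ⟨l₀, hl₀, φ, hφ, hlim⟩ := (isCompact_sphere (0 : E) 1).tendsto_subseq hl
  refine ⟨l₀, by simpa using hl₀, fun a ha => ?_⟩
  exact le_of_tendsto_of_tendsto' (hlim.inner tendsto_const_nhds)
    (hlim.inner (hqx.comp hφ.tendsto_atTop)) fun k => hla (φ k) a ha

/-- If two compact sets, the first of them convex, have Hausdorff distance at most `ε`, then every
frontier point of the first is within `ε` of a frontier point of the second. -/
theorem exists_mem_frontier_dist_le_hausdorffDist {E : Type*} [NormedAddCommGroup E]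
    [InnerProductSpace ℝ E] [FiniteDimensional ℝ E] {A B : Set E} (hA : IsCompact A)
    (hconv : Convex ℝ A) (hB : IsCompact B) (hBne : B.Nonempty) {x : E} (hx : x ∈ frontier A) :
    ∃ z ∈ frontier B, dist x z ≤ Metric.hausdorffDist A B := by
  have hxA : x ∈ A := hA.isClosed.frontier_subset hx
  have hfin : Metric.hausdorffEDist A B ≠ ⊤ :=
    Metric.hausdorffEDist_ne_top_of_nonempty_of_bounded ⟨x, hxA⟩ hBne hA.isBounded hB.isBounded
  by_cases hxB : x ∈ B
  · obtain ⟨l, hl, hla⟩ := exists_norm_eq_one_inner_le_of_mem_frontier hA.isClosed hconv hx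
    -- Follow the outer normal of `A` from `x` to the last point of the ray that is still in `B`.
    let I : Set ℝ := {s | 0 ≤ s ∧ x + s • l ∈ B}
    obtain ⟨R, hR⟩ := hB.isBounded.exists_norm_le
    have hIclosed : IsClosed I :=
      isClosed_Ici.inter (hB.isClosed.preimage (by fun_prop : Continuous fun s : ℝ => x + s • l))
    have hIbdd : BddAbove I := by
      refine ⟨R + ‖x‖, fun s hs => ?_⟩
      have h1 := hR _ hs.2
      have h2 : ‖s • l‖ ≤ ‖x + s • l‖ + ‖x‖ := by
        have := norm_sub_le (x + s • l) x
        rwa [add_sub_cancel_left] at this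
      rw [norm_smul, hl, mul_one, Real.norm_of_nonneg hs.1] at h2
      linarith
    have hI0 : (0 : ℝ) ∈ I := ⟨le_rfl, by simpa using hxB⟩
    have hsI := hIclosed.csSup_mem ⟨0, hI0⟩ hIbdd
    set s := sSup I
    refine ⟨x + s • l, ⟨subset_closure hsI.2, fun hint => ?_⟩, ?_⟩
    · have hcont : Filter.Tendsto (fun r : ℝ => x + r • l) (nhds s) (nhds (x + s • l)) :=
        Continuous.tendsto (by fun_prop) s
      have hev := hcont.eventually (mem_interior_iff_mem_nhds.1 hint)
      obtain ⟨δ, hδ, hball⟩ := Metric.eventually_nhds_iff.1 hev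
      have hmem : s + δ / 2 ∈ I := by
        refine ⟨by have := hsI.1; positivity, hball ?_⟩
        rw [Real.dist_eq, add_sub_cancel_left, abs_of_pos (half_pos hδ)]
        exact half_lt_self hδ
      have := le_csSup hIbdd hmem
      linarith
    · have hd : dist x (x + s • l) = s := by
        rw [dist_self_add_right, norm_smul, hl, mul_one, Real.norm_of_nonneg hsI.1]
      rw [hd, Metric.hausdorffDist_comm]
      refine le_trans ?_ (Metric.infDist_le_hausdorffDist_of_mem hsI.2
        (by rwa [Metric.hausdorffEDist_comm]))
      -- `A` lies in the half-space behind `x`, so no point of `A` is closer than `s` to the exit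
      -- point.
      refine (Metric.le_infDist ⟨x, hxA⟩).2 fun a ha => ?_
      have h1 := hla a ha
      have h2 : inner ℝ l (x + s • l - a) ≤ ‖l‖ * ‖x + s • l - a‖ := real_inner_le_norm _ _
      rw [inner_sub_right, inner_add_right, real_inner_smul_right, real_inner_self_eq_norm_sq, hl,
        one_mul] at h2
      rw [dist_eq_norm]
      linarith
  -- Outside `B`, take a nearest point of `B`. If it were interior, a small step from it toward `x`
  -- would stay in `B` and come closer to `x`.
  · obtain ⟨z, hz, hxz⟩ := hB.exists_infDist_eq_dist hBne x
    refine ⟨z, ⟨subset_closure hz, fun hint => ?_⟩,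
      hxz ▸ Metric.infDist_le_hausdorffDist_of_mem hxA hfin⟩
    have hcont : Filter.Tendsto (fun r : ℝ => AffineMap.lineMap z x r) (nhds 0) (nhds z) := by
      have : Continuous fun r : ℝ => (AffineMap.lineMap z x r : E) := AffineMap.lineMap_continuous
      simpa using this.tendsto 0
    obtain ⟨δ, hδ, hball⟩ :=
      Metric.eventually_nhds_iff.1 (hcont.eventually (mem_interior_iff_mem_nhds.1 hint))
    set r := min (δ / 2) 1
    have hr0 : 0 < r := by positivity
    have hmem : AffineMap.lineMap z x r ∈ B := hball (by
      rw [dist_zero_right, Real.norm_of_nonneg hr0.le]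
      exact (min_le_left _ _).trans_lt (half_lt_self hδ))
    have h1 := Metric.infDist_le_dist_of_mem (x := x) hmem
    rw [hxz, dist_comm x (AffineMap.lineMap z x r), dist_lineMap_right,
      Real.norm_of_nonneg (sub_nonneg.2 (min_le_right _ _)), dist_comm z x] at h1
    have hpos : 0 < dist x z := dist_pos.2 fun h => hxB (h ▸ hz)
    nlinarith

/-! ### Volterra operators with integrable coefficients -/

theorem IntegrableOn.intervalIntegrable_of_mem_Icc {E : Type*} [NormedAddCommGroup E] {a b : ℝ}
    {f : ℝ → E} (hf : IntegrableOn f (Icc a b))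
    {s t : ℝ} (hs : s ∈ Icc a b) (ht : t ∈ Icc a b) : IntervalIntegrable f volume s t :=
  (hf.mono_set (uIcc_subset_Icc hs ht)).intervalIntegrable

section Volterra

variable {E F : Type*} [NormedAddCommGroup E] [NormedSpace ℝ E] [NormedAddCommGroup F]
  [NormedSpace ℝ F] {a b : ℝ}

theorem integrableOn_clm_apply {A : ℝ → E →L[ℝ] F} (hA : IntegrableOn A (Icc a b)) {g : ℝ → E}
    (hg : AEStronglyMeasurable g (volume.restrict (Icc a b))) {M : ℝ}
    (hM : ∀ᵐ r ∂volume.restrict (Icc a b), ‖g r‖ ≤ M) :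
    IntegrableOn (fun r => A r (g r)) (Icc a b) := by
  refine (hA.norm.mul_const M).mono'
    ((ContinuousLinearMap.id ℝ (E →L[ℝ] F)).aestronglyMeasurable_comp₂ hA.1 hg) ?_
  filter_upwards [hM] with r hr
  exact (A r).le_opNorm_of_le hr

/-- The primitive of `f` on `[a, b]` that vanishes at `b`. -/
noncomputable def primitiveFromRight (f : ℝ → E) (hf : IntegrableOn f (Icc a b)) :
    C(Icc a b, E) where
  toFun s := ∫ r in b..s, f r
  continuous_toFun := by
    rcases le_or_gt a b with hab | hab
    · have h : ContinuousOn (fun s => ∫ r in b..s, f r) (uIcc b a) :=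
        intervalIntegral.continuousOn_primitive_interval (by rwa [uIcc_of_ge hab])
      rw [uIcc_of_ge hab] at h
      exact h.domRestrict
    · have : IsEmpty (Icc a b) := by simp [hab]
      exact continuous_of_const fun x => (this.false x).elim

@[simp]
theorem primitiveFromRight_apply (f : ℝ → E) (hf : IntegrableOn f (Icc a b)) (s : Icc a b) :
    primitiveFromRight f hf s = ∫ r in b..s, f r := rfl

theorem norm_primitiveFromRight_apply_le (f : ℝ → E) (hf : IntegrableOn f (Icc a b))
    (s : Icc a b) : ‖primitiveFromRight f hf s‖ ≤ ∫ r in (s : ℝ)..b, ‖f r‖ := by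
  rw [primitiveFromRight_apply, intervalIntegral.integral_symm, norm_neg]
  exact intervalIntegral.norm_integral_le_integral_norm s.2.2

theorem norm_primitiveFromRight_le (f : ℝ → E) (hf : IntegrableOn f (Icc a b)) :
    ‖primitiveFromRight f hf‖ ≤ ∫ r in Icc a b, ‖f r‖ := by
  refine (ContinuousMap.norm_le _ (by positivity)).2 fun s => ?_
  refine (norm_primitiveFromRight_apply_le f hf s).trans ?_
  rw [intervalIntegral.integral_of_le s.2.2]
  refine setIntegral_mono_set hf.norm (Filter.Eventually.of_forall fun _ => norm_nonneg _) ?_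
  exact (Ioc_subset_Icc_self.trans (Icc_subset_Icc_left s.2.1)).eventuallyLE

theorem integrableOn_clm_apply_IccExtend (hab : a ≤ b) {A : ℝ → E →L[ℝ] F}
    (hA : IntegrableOn A (Icc a b)) (y : C(Icc a b, E)) :
    IntegrableOn (fun r => A r (IccExtend hab y r)) (Icc a b) :=
  integrableOn_clm_apply hA
    ((y.continuous.Icc_extend' (h := hab)).stronglyMeasurable.aestronglyMeasurable)
    (Filter.Eventually.of_forall fun _ => y.norm_coe_le_norm _)

/-- The Volterra operator `y ↦ ∫_b^s A(r) y(r) dr` on `C([a, b])`. -/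
noncomputable def volterra (hab : a ≤ b) (A : ℝ → E →L[ℝ] E) (hA : IntegrableOn A (Icc a b)) :
    C(Icc a b, E) →L[ℝ] C(Icc a b, E) :=
  LinearMap.mkContinuous
    { toFun := fun y => primitiveFromRight _ (integrableOn_clm_apply_IccExtend hab hA y)
      map_add' := fun y z => by
        ext s
        have hb : b ∈ Icc a b := right_mem_Icc.2 hab
        rw [ContinuousMap.add_apply]
        simp only [primitiveFromRight_apply]
        rw [← intervalIntegral.integral_add
          (IntegrableOn.intervalIntegrable_of_mem_Icc
            (integrableOn_clm_apply_IccExtend hab hA y) hb s.2)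
          (IntegrableOn.intervalIntegrable_of_mem_Icc
            (integrableOn_clm_apply_IccExtend hab hA z) hb s.2)]
        simp [IccExtend]
      map_smul' := fun c y => by
        ext s
        simp [IccExtend, intervalIntegral.integral_smul] }
    (∫ r in Icc a b, ‖A r‖) fun y => by
      refine (norm_primitiveFromRight_le _ (integrableOn_clm_apply_IccExtend hab hA y)).trans ?_
      rw [← integral_mul_const]
      refine integral_mono (integrableOn_clm_apply_IccExtend hab hA y).norm
        (hA.norm.mul_const _) fun r => ?_
      exact (A r).le_opNorm_of_le (y.norm_coe_le_norm _)

theorem volterra_apply (hab : a ≤ b) (A : ℝ → E →L[ℝ] E) (hA : IntegrableOn A (Icc a b))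
    (y : C(Icc a b, E)) (s : Icc a b) :
    volterra hab A hA y s = ∫ r in b..s, A r (IccExtend hab y r) := rfl

/-- By dominated convergence, the part of an integrable function above level `M` has integral
tending to `0` as `M` grows. -/
theorem exists_setIntegral_max_sub_le {α : ℝ → ℝ} (hα : IntegrableOn α (Icc a b)) {ε : ℝ}
    (hε : 0 < ε) : ∃ M : ℝ, 0 ≤ M ∧ ∫ r in Icc a b, max (α r - M) 0 ≤ ε := by
  have h : Filter.Tendsto (fun k : ℕ => ∫ r in Icc a b, max (α r - k) 0) Filter.atTop
      (nhds (∫ r in Icc a b, (0 : ℝ))) := by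
    refine tendsto_integral_of_dominated_convergence (fun r => |α r|) (fun k => ?_) hα.abs
      (fun k => Filter.Eventually.of_forall fun r => ?_) (Filter.Eventually.of_forall fun r => ?_)
    · exact ((hα.1.sub aestronglyMeasurable_const).sup aestronglyMeasurable_const)
    · rw [Real.norm_of_nonneg (le_max_right _ _)]
      refine max_le ?_ (abs_nonneg _)
      have := le_abs_self (α r)
      have : (0 : ℝ) ≤ k := k.cast_nonneg
      linarith
    · obtain ⟨k, hk⟩ := exists_nat_ge (α r)
      refine tendsto_const_nhds.congr' ?_
      filter_upwards [Filter.eventually_ge_atTop k] with l hl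
      have : (k : ℝ) ≤ l := by exact_mod_cast hl
      rw [max_eq_right (by linarith)]
  rw [integral_zero] at h
  obtain ⟨k, hk⟩ := (h.eventually (eventually_le_nhds hε)).exists
  exact ⟨k, k.cast_nonneg, hk⟩

/-- An exponential weight makes the Volterra operator with kernel bound `α` a contraction by `1/2`.
Split `α ≤ M + (α - M)⁺` with the excess of integral at most `1/4`. With `c = 4 * M` the bounded
part also contributes at most a quarter of the weight. -/
theorem exists_exp_weight (hab : a ≤ b) {α : ℝ → ℝ} (hα : IntegrableOn α (Icc a b)) :
    ∃ c : ℝ, 0 ≤ c ∧ ∀ s ∈ Icc a b,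
      ∫ r in s..b, α r * Real.exp (c * (b - r)) ≤ 1 / 2 * Real.exp (c * (b - s)) := by
  obtain ⟨M, hM, hMα⟩ := exists_setIntegral_max_sub_le hα (by norm_num : (0 : ℝ) < 1 / 4)
  refine ⟨4 * M, by positivity, fun s hs => ?_⟩
  set c := 4 * M with hc
  have hb : b ∈ Icc a b := right_mem_Icc.2 hab
  have hαi := IntegrableOn.intervalIntegrable_of_mem_Icc hα hs hb
  have hexp : Continuous fun r => Real.exp (c * (b - r)) := by fun_prop
  have hβ : IntegrableOn (fun r => max (α r - M) 0) (Icc a b) :=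
    (hα.sub (integrableOn_const (by simp))).pos_part
  have hβi := IntegrableOn.intervalIntegrable_of_mem_Icc hβ hs hb
  have hexp_int : ∫ r in s..b, c * Real.exp (c * (b - r)) = Real.exp (c * (b - s)) - 1 := by
    have hd : ∀ r ∈ uIcc s b,
        HasDerivAt (fun r => -Real.exp (c * (b - r))) (c * Real.exp (c * (b - r))) r := by
      intro r _
      have h := (((hasDerivAt_id r).const_sub b).const_mul c).exp.neg
      refine h.congr_deriv ?_
      simp
      ring
    rw [intervalIntegral.integral_eq_sub_of_hasDerivAt hd
      (Continuous.intervalIntegrable (by fun_prop) _ _)]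
    simp
    ring
  have hβle : ∫ r in s..b, max (α r - M) 0 ≤ 1 / 4 := by
    refine le_trans ?_ hMα
    rw [intervalIntegral.integral_of_le hs.2]
    refine setIntegral_mono_set hβ (Filter.Eventually.of_forall fun _ => le_max_right _ _) ?_
    exact (Ioc_subset_Icc_self.trans (Icc_subset_Icc_left hs.1)).eventuallyLE
  calc ∫ r in s..b, α r * Real.exp (c * (b - r))
      ≤ ∫ r in s..b, (1 / 4 * (c * Real.exp (c * (b - r))) +
          max (α r - M) 0 * Real.exp (c * (b - s))) := by
        refine intervalIntegral.integral_mono_on hs.2 (hαi.mul_continuousOn hexp.continuousOn)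
          ((Continuous.intervalIntegrable (by fun_prop) _ _).add (hβi.mul_const _)) fun r hr => ?_
        have h1 : Real.exp (c * (b - r)) ≤ Real.exp (c * (b - s)) := by
          gcongr
          exact hr.1
        have h2 : α r * Real.exp (c * (b - r)) ≤
            (M + max (α r - M) 0) * Real.exp (c * (b - r)) := by
          refine mul_le_mul_of_nonneg_right ?_ (Real.exp_pos _).le
          linarith [le_max_left (α r - M) 0]
        have h3 := mul_le_mul_of_nonneg_left h1 (le_max_right (α r - M) 0)
        rw [hc] at *
        linarith
    _ = 1 / 4 * (Real.exp (c * (b - s)) - 1) +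
          (∫ r in s..b, max (α r - M) 0) * Real.exp (c * (b - s)) := by
        rw [intervalIntegral.integral_add (Continuous.intervalIntegrable (by fun_prop) _ _)
          (hβi.mul_const _), intervalIntegral.integral_const_mul,
          intervalIntegral.integral_mul_const, hexp_int]
    _ ≤ 1 / 2 * Real.exp (c * (b - s)) := by
        have := mul_le_mul_of_nonneg_right hβle (Real.exp_pos (c * (b - s))).le
        linarith

/-- Each application of the operator halves the norm weighted by `exp (-c (b - s))`; the bound is
this contraction, unwound to a pointwise estimate. -/
theorem norm_volterra_pow_apply_le (hab : a ≤ b) {A : ℝ → E →L[ℝ] E}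
    (hA : IntegrableOn A (Icc a b)) {c : ℝ}
    (hc : ∀ s ∈ Icc a b,
      ∫ r in s..b, ‖A r‖ * Real.exp (c * (b - r)) ≤ 1 / 2 * Real.exp (c * (b - s)))
    (hc0 : 0 ≤ c) (y : C(Icc a b, E)) (k : ℕ) (s : Icc a b) :
    ‖(volterra hab A hA ^ k) y s‖ ≤ (1 / 2) ^ k * Real.exp (c * (b - s)) * ‖y‖ := by
  induction k generalizing s with
  | zero =>
    rw [pow_zero, pow_zero, one_mul]
    have h1 : 1 ≤ Real.exp (c * (b - s)) :=
      Real.one_le_exp (mul_nonneg hc0 (sub_nonneg.2 s.2.2))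
    exact (y.norm_coe_le_norm s).trans (le_mul_of_one_le_left (norm_nonneg _) h1)
  | succ k ih =>
    set z := (volterra hab A hA ^ k) y
    have hz : (volterra hab A hA ^ (k + 1)) y = volterra hab A hA z := by
      rw [pow_succ']; rfl
    have hb : b ∈ Icc a b := right_mem_Icc.2 hab
    have hint := IntegrableOn.intervalIntegrable_of_mem_Icc hA.norm s.2 hb
    rw [hz]
    calc ‖volterra hab A hA z s‖
        ≤ ∫ r in (s : ℝ)..b, ‖A r (IccExtend hab z r)‖ :=
          norm_primitiveFromRight_apply_le _ (integrableOn_clm_apply_IccExtend hab hA z) s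
      _ ≤ ∫ r in (s : ℝ)..b, (‖A r‖ * Real.exp (c * (b - r))) * ((1 / 2) ^ k * ‖y‖) := by
          refine intervalIntegral.integral_mono_on s.2.2
            (IntegrableOn.intervalIntegrable_of_mem_Icc
              (integrableOn_clm_apply_IccExtend hab hA z).norm s.2 hb)
            ((hint.mul_continuousOn (Continuous.continuousOn (by fun_prop))).mul_const _)
            fun r hr => ?_
          have hr' : r ∈ Icc a b := ⟨s.2.1.trans hr.1, hr.2⟩
          rw [IccExtend_of_mem hab z hr']
          refine ((A r).le_opNorm_of_le (ih ⟨r, hr'⟩)).trans_eq ?_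
          ring
      _ = (∫ r in (s : ℝ)..b, ‖A r‖ * Real.exp (c * (b - r))) * ((1 / 2) ^ k * ‖y‖) :=
          intervalIntegral.integral_mul_const _ _
      _ ≤ (1 / 2 * Real.exp (c * (b - s))) * ((1 / 2) ^ k * ‖y‖) :=
          mul_le_mul_of_nonneg_right (hc s s.2) (by positivity)
      _ = (1 / 2) ^ (k + 1) * Real.exp (c * (b - s)) * ‖y‖ := by ring

/-- The weight is at most `exp (c (b - a))`, so some power `V ^ k` has norm below `1` in the usual
sup norm. Then `1 - V ^ k` is invertible, and so is its factor `1 - V`, because it commutes with the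
cofactor. -/
theorem isUnit_one_sub_volterra [CompleteSpace E] (hab : a ≤ b) {A : ℝ → E →L[ℝ] E}
    (hA : IntegrableOn A (Icc a b)) : IsUnit (1 - volterra hab A hA) := by
  obtain ⟨c, hc0, hc⟩ := exists_exp_weight hab hA.norm
  have hlim : Filter.Tendsto (fun k : ℕ => (1 / 2 : ℝ) ^ k * Real.exp (c * (b - a)))
      Filter.atTop (nhds (0 * Real.exp (c * (b - a)))) :=
    (tendsto_pow_atTop_nhds_zero_of_lt_one (by norm_num) (by norm_num)).mul_const _
  rw [zero_mul] at hlim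
  obtain ⟨k, hk⟩ := (hlim.eventually (eventually_lt_nhds one_pos)).exists
  have hnorm : ‖volterra hab A hA ^ k‖ < 1 := by
    refine lt_of_le_of_lt (ContinuousLinearMap.opNorm_le_bound _ (by positivity) fun y => ?_) hk
    refine (ContinuousMap.norm_le _ (by positivity)).2 fun s => ?_
    refine (norm_volterra_pow_apply_le hab hA hc hc0 y k s).trans ?_
    gcongr
    exact s.2.1
  have hu := isUnit_one_sub_of_norm_lt_one
    (R := C(Icc a b, E) →L[ℝ] C(Icc a b, E)) hnorm
  have h1 := (Commute.one_left (volterra hab A hA)).mul_geom_sum₂ k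
  have hcomm : Commute (1 - volterra hab A hA)
      (∑ i ∈ Finset.range k, 1 ^ i * volterra hab A hA ^ (k - 1 - i)) := by
    refine Commute.sum_right _ _ _ fun i _ => ?_
    rw [one_pow, one_mul]
    exact ((Commute.one_left _).sub_left (Commute.refl _)).pow_right _
  rw [one_pow] at h1
  rw [← h1] at hu
  exact (hcomm.isUnit_mul_iff.1 hu).1

end Volterra

/-! ### The linear state equation solved backward from the end time -/

section LinearEquation

variable {E : Type*} [NormedAddCommGroup E] [NormedSpace ℝ E] [CompleteSpace E] {a b : ℝ}

/-- `x` is the initial value at `a` of a solution of `ẏ = A y + g` that ends in `z` at `b` if and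
only if it is the value at `a` of the solution of the Volterra equation backward from `b`. -/
theorem exists_caratheodory_solution_iff (hab : a ≤ b) {A : ℝ → E →L[ℝ] E}
    (hA : IntegrableOn A (Icc a b)) {g : ℝ → E} (hg : IntegrableOn g (Icc a b)) (x z : E) :
    (∃ y : ℝ → E, (ContinuousOn y (Icc a b) ∧
        ∀ s ∈ Icc a b, y s = x + ∫ r in a..s, (A r (y r) + g r)) ∧ y b = z) ↔
      Ring.inverse (1 - volterra hab A hA)
        (ContinuousMap.const _ z + primitiveFromRight g hg) ⟨a, left_mem_Icc.2 hab⟩ = x := by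
  have ha : a ∈ Icc a b := left_mem_Icc.2 hab
  have hb : b ∈ Icc a b := right_mem_Icc.2 hab
  have hu := isUnit_one_sub_volterra hab hA
  have hsplit : ∀ (y : C(Icc a b, E)), ∀ s ∈ Icc a b, ∫ r in b..s, (A r (IccExtend hab y r) + g r) =
      (∫ r in b..s, A r (IccExtend hab y r)) + ∫ r in b..s, g r := fun y s hs =>
    intervalIntegral.integral_add
      (IntegrableOn.intervalIntegrable_of_mem_Icc (integrableOn_clm_apply_IccExtend hab hA y) hb hs)
      (IntegrableOn.intervalIntegrable_of_mem_Icc hg hb hs)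
  constructor
  · rintro ⟨y, ⟨hyc, hy⟩, rfl⟩
    let Y : C(Icc a b, E) := ⟨_, hyc.domRestrict⟩
    have hY : ∀ r ∈ Icc a b, IccExtend hab Y r = y r := fun r hr => IccExtend_of_mem hab Y hr
    have hF : ∀ s ∈ Icc a b, ∀ s' ∈ Icc a b, ∫ r in s..s', (A r (y r) + g r) =
        ∫ r in s..s', (A r (IccExtend hab Y r) + g r) := fun s hs s' hs' =>
      intervalIntegral.integral_congr fun r hr => by
        simp only [hY r (uIcc_subset_Icc hs hs' hr)]
    have hFint : IntegrableOn (fun r => A r (IccExtend hab Y r) + g r) (Icc a b) :=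
      (integrableOn_clm_apply_IccExtend hab hA Y).add hg
    have hkey : (1 - volterra hab A hA) Y =
        ContinuousMap.const _ (y b) + primitiveFromRight g hg := by
      ext s
      have h1 : Y s = y b + ∫ r in b..s, (A r (IccExtend hab Y r) + g r) := by
        change y s = _
        rw [hy s s.2, hy b hb, hF a ha s s.2, hF a ha b hb, add_assoc,
          intervalIntegral.integral_add_adjacent_intervals
            (IntegrableOn.intervalIntegrable_of_mem_Icc hFint ha hb)
            (IntegrableOn.intervalIntegrable_of_mem_Icc hFint hb s.2)]
      change Y s - volterra hab A hA Y s = y b + ∫ r in b..s, g r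
      rw [h1, volterra_apply, hsplit Y s s.2]
      abel
    rw [← hkey]
    change ((Ring.inverse (1 - volterra hab A hA) * (1 - volterra hab A hA)) Y) ⟨a, ha⟩ = x
    rw [Ring.inverse_mul_cancel _ hu]
    change y a = x
    simpa using hy a ha
  · rintro rfl
    set Y := Ring.inverse (1 - volterra hab A hA)
      (ContinuousMap.const _ z + primitiveFromRight g hg)
    have hkey : (1 - volterra hab A hA) Y = ContinuousMap.const _ z + primitiveFromRight g hg := by
      change ((1 - volterra hab A hA) * Ring.inverse (1 - volterra hab A hA)) _ = _
      rw [Ring.mul_inverse_cancel _ hu]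
      rfl
    have hFint : IntegrableOn (fun r => A r (IccExtend hab Y r) + g r) (Icc a b) :=
      (integrableOn_clm_apply_IccExtend hab hA Y).add hg
    have hval : ∀ s (hs : s ∈ Icc a b),
        Y ⟨s, hs⟩ = z + ∫ r in b..s, (A r (IccExtend hab Y r) + g r) := by
      intro s hs
      have h1 : Y ⟨s, hs⟩ - ∫ r in b..s, A r (IccExtend hab Y r) = z + ∫ r in b..s, g r :=
        DFunLike.congr_fun hkey ⟨s, hs⟩
      rw [hsplit Y s hs, eq_add_of_sub_eq h1]
      abel
    refine ⟨IccExtend hab Y, ⟨(Y.continuous.Icc_extend' (h := hab)).continuousOn, fun s hs => ?_⟩,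
      ?_⟩
    · rw [IccExtend_of_mem hab Y hs, hval s hs, hval a ha, add_assoc,
        intervalIntegral.integral_add_adjacent_intervals
          (IntegrableOn.intervalIntegrable_of_mem_Icc hFint hb ha)
          (IntegrableOn.intervalIntegrable_of_mem_Icc hFint ha hs)]
    · rw [IccExtend_of_mem hab Y hb, hval b hb]
      simp

end LinearEquation

/-! ### Controls as a closed convex subset of `L²` -/

section Controls

/-- The square integrable functions on `[a, b]` with values in `U`. -/
def lpControls {V : Type*} [NormedAddCommGroup V] (a b : ℝ) (U : Set V) :
    Set (Lp V 2 (volume.restrict (Icc a b))) :=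
  {u | ∀ᵐ r ∂volume.restrict (Icc a b), u r ∈ U}

theorem exists_subseq_tendsto_ae_of_tendsto_Lp {V : Type*} [NormedAddCommGroup V] {a b : ℝ}
    {x : ℕ → Lp V 2 (volume.restrict (Icc a b))} {u : Lp V 2 (volume.restrict (Icc a b))}
    (h : Filter.Tendsto x Filter.atTop (nhds u)) :
    ∃ φ : ℕ → ℕ, StrictMono φ ∧ ∀ᵐ r ∂volume.restrict (Icc a b),
      Filter.Tendsto (fun k => x (φ k) r) Filter.atTop (nhds (u r)) :=
  (tendstoInMeasure_of_tendsto_Lp h).exists_seq_tendsto_ae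

theorem isClosed_lpControls {V : Type*} [NormedAddCommGroup V] {a b : ℝ} {U : Set V}
    (hU : IsClosed U) : IsClosed (lpControls a b U) := by
  refine IsSeqClosed.isClosed fun x u hx hu => ?_
  obtain ⟨φ, -, hφ⟩ := exists_subseq_tendsto_ae_of_tendsto_Lp hu
  filter_upwards [hφ, ae_all_iff.2 fun k => hx (φ k)] with r hr hr'
  exact hU.mem_of_tendsto hr (Filter.Eventually.of_forall hr')

theorem isBounded_lpControls {V : Type*} [NormedAddCommGroup V] {a b : ℝ}
    {U : Set V} (hU : Bornology.IsBounded U) :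
    Bornology.IsBounded (lpControls a b U) := by
  obtain ⟨R, hR, hUR⟩ := hU.exists_pos_norm_le
  refine isBounded_iff_forall_norm_le.2 ⟨_, fun u hu => Lp.norm_le_of_ae_bound hR.le ?_⟩
  filter_upwards [hu] with r hr using hUR _ hr

variable {V : Type*} [NormedAddCommGroup V] [InnerProductSpace ℝ V] {a b : ℝ}

theorem convex_lpControls {U : Set V} (hU : Convex ℝ U) : Convex ℝ (lpControls a b U) := by
  intro u hu v hv α β hα hβ hαβ
  filter_upwards [hu, hv, Lp.coeFn_add (α • u) (β • v), Lp.coeFn_smul α u, Lp.coeFn_smul β v]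
    with r h1 h2 h3 h4 h5
  rw [h3, Pi.add_apply, h4, h5]
  exact hU h1 h2 hα hβ hαβ

variable {E : Type*} [NormedAddCommGroup E] [NormedSpace ℝ E]

theorem integrableOn_clm_apply_lpControls {B : ℝ → V →L[ℝ] E} (hB : IntegrableOn B (Icc a b))
    {U : Set V} (hU : Bornology.IsBounded U) {u : Lp V 2 (volume.restrict (Icc a b))}
    (hu : u ∈ lpControls a b U) : IntegrableOn (fun r => B r (u r)) (Icc a b) := by
  obtain ⟨R, hUR⟩ := hU.exists_norm_le
  refine integrableOn_clm_apply hB (Lp.aestronglyMeasurable u) (M := R) ?_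
  filter_upwards [hu] with r hr using hUR _ hr

/-- The primitive of `r ↦ B(r) u(r)`, as a function of the control `u`. -/
noncomputable def controlPrimitive {B : ℝ → V →L[ℝ] E} (hB : IntegrableOn B (Icc a b))
    {U : Set V} (hU : Bornology.IsBounded U) (u : lpControls a b U) : C(Icc a b, E) :=
  primitiveFromRight (fun r => B r ((u : Lp V 2 (volume.restrict (Icc a b))) r))
    (integrableOn_clm_apply_lpControls hB hU u.2)

/-- As `B` is only integrable, `u ↦ B u` need not be bounded from `L²` to `L¹`. On controls with
values in the bounded set `U`, dominated convergence applies along subsequences that converge almost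
everywhere, and this suffices. -/
theorem continuous_controlPrimitive {B : ℝ → V →L[ℝ] E} (hB : IntegrableOn B (Icc a b))
    {U : Set V} (hU : Bornology.IsBounded U) : Continuous (controlPrimitive hB hU) := by
  obtain ⟨R, hUR⟩ := hU.exists_norm_le
  rw [continuous_iff_seqContinuous]
  intro x u hx
  refine Filter.tendsto_of_subseq_tendsto fun ns hns => ?_
  obtain ⟨φ, hφ, hlim⟩ := exists_subseq_tendsto_ae_of_tendsto_Lp
    ((continuous_subtype_val.tendsto u).comp (hx.comp hns))
  refine ⟨φ, tendsto_iff_norm_sub_tendsto_zero.2 ?_⟩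
  have hint : ∀ k, IntegrableOn (fun r => B r ((x (ns (φ k))).1 r) - B r (u.1 r)) (Icc a b) :=
    fun k => (integrableOn_clm_apply_lpControls hB hU (x (ns (φ k))).2).sub
      (integrableOn_clm_apply_lpControls hB hU u.2)
  have hdct : Filter.Tendsto
      (fun k => ∫ r in Icc a b, ‖B r ((x (ns (φ k))).1 r) - B r (u.1 r)‖)
      Filter.atTop (nhds (∫ r in Icc a b, (0 : ℝ))) := by
    refine tendsto_integral_of_dominated_convergence (fun r => ‖B r‖ * (R + R))
      (fun k => (hint k).norm.1) (hB.norm.mul_const _) (fun k => ?_) ?_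
    · filter_upwards [u.2, (x (ns (φ k))).2] with r h1 h2
      rw [norm_norm, ← map_sub]
      exact (B r).le_opNorm_of_le ((norm_sub_le _ _).trans (add_le_add (hUR _ h2) (hUR _ h1)))
    · filter_upwards [hlim] with r hr
      exact tendsto_iff_norm_sub_tendsto_zero.1 (((B r).continuous.tendsto _).comp hr)
  rw [integral_zero] at hdct
  refine squeeze_zero (fun _ => norm_nonneg _) (fun k => ?_) hdct
  refine le_trans (le_of_eq ?_) (norm_primitiveFromRight_le _ (hint k))
  congr 1
  ext s
  have hb : b ∈ Icc a b := ⟨s.2.1.trans s.2.2, le_rfl⟩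
  exact (intervalIntegral.integral_sub
    (IntegrableOn.intervalIntegrable_of_mem_Icc
      (integrableOn_clm_apply_lpControls hB hU (x (ns (φ k))).2) hb s.2)
    (IntegrableOn.intervalIntegrable_of_mem_Icc
      (integrableOn_clm_apply_lpControls hB hU u.2) hb s.2)).symm

theorem controlPrimitive_combo {B : ℝ → V →L[ℝ] E} (hB : IntegrableOn B (Icc a b))
    {U : Set V} (hU : Bornology.IsBounded U) (u v w : lpControls a b U) {α β : ℝ}
    (hw : (w : Lp V 2 (volume.restrict (Icc a b))) = α • u.1 + β • v.1) :
    controlPrimitive hB hU w = α • controlPrimitive hB hU u + β • controlPrimitive hB hU v := by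
  ext s
  have hb : b ∈ Icc a b := ⟨s.2.1.trans s.2.2, le_rfl⟩
  have hu := IntegrableOn.intervalIntegrable_of_mem_Icc
    (integrableOn_clm_apply_lpControls hB hU u.2) hb s.2
  have hv := IntegrableOn.intervalIntegrable_of_mem_Icc
    (integrableOn_clm_apply_lpControls hB hU v.2) hb s.2
  change ∫ r in b..s, B r (w.1 r) =
    α • (∫ r in b..s, B r (u.1 r)) + β • ∫ r in b..s, B r (v.1 r)
  rw [← intervalIntegral.integral_smul, ← intervalIntegral.integral_smul,
    ← intervalIntegral.integral_add (f := fun r => α • B r (u.1 r)) (g := fun r => β • B r (v.1 r))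
      (hu.smul α) (hv.smul β)]
  refine intervalIntegral.integral_congr_ae_restrict ?_
  refine ae_restrict_of_ae_restrict_of_subset
    (uIoc_subset_uIcc.trans (uIcc_subset_Icc hb s.2)) ?_
  filter_upwards [Lp.coeFn_add (α • u.1) (β • v.1), Lp.coeFn_smul α u.1, Lp.coeFn_smul β v.1]
    with r h1 h2 h3
  rw [hw, h1, Pi.add_apply, h2, h3]
  simp

theorem norm_controlPrimitive_le {B : ℝ → V →L[ℝ] E} (hB : IntegrableOn B (Icc a b))
    {U : Set V} (hU : Bornology.IsBounded U) :
    ∃ M, ∀ u : lpControls a b U, ‖controlPrimitive hB hU u‖ ≤ M := by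
  obtain ⟨R, hUR⟩ := hU.exists_norm_le
  refine ⟨∫ r in Icc a b, ‖B r‖ * R, fun u => (norm_primitiveFromRight_le _
    (integrableOn_clm_apply_lpControls hB hU u.2)).trans ?_⟩
  refine integral_mono_ae (integrableOn_clm_apply_lpControls hB hU u.2).norm
    (hB.norm.mul_const R) ?_
  filter_upwards [u.2] with r hr using (B r).le_opNorm_of_le (hUR _ hr)

/-- The image of the controls under a continuous linear functional of the primitive of `B u` is
compact. -/
theorem isCompact_range_controlPrimitive [CompleteSpace V] {F : Type*} [NormedAddCommGroup F]
    [NormedSpace ℝ F] [FiniteDimensional ℝ F] {B : ℝ → V →L[ℝ] E} (hB : IntegrableOn B (Icc a b))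
    {U : Set V} (hU : IsCompact U) (hconv : Convex ℝ U) (Λ : C(Icc a b, E) →L[ℝ] F) :
    IsCompact (range fun u : lpControls a b U => Λ (controlPrimitive hB hU.isBounded u)) := by
  have := FiniteDimensional.proper_real F
  set f₀ : lpControls a b U → F := fun u => Λ (controlPrimitive hB hU.isBounded u) with hf₀
  -- The extension by `0` only serves to have a map on the whole Hilbert space; it is evaluated on
  -- the controls alone.
  let f : Lp V 2 (volume.restrict (Icc a b)) → F := Function.extend Subtype.val f₀ 0
  have hf : ∀ u : lpControls a b U, f u = f₀ u := Subtype.val_injective.extend_apply f₀ 0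
  have himage : range f₀ = f '' lpControls a b U := by
    ext z
    simp only [mem_range, mem_image, Subtype.exists, ← hf, exists_prop]
  refine Metric.isCompact_of_isClosed_isBounded ?_ ?_
  · rw [himage]
    refine isClosed_image_of_affineOn (isClosed_lpControls hU.isClosed) (convex_lpControls hconv)
      (isBounded_lpControls hU.isBounded) ?_ ?_
    · rw [continuousOn_iff_continuous_domRestrict]
      refine (Λ.continuous.comp (continuous_controlPrimitive hB hU.isBounded)).congr fun u => ?_
      exact (hf u).symm
    · intro u hu v hv α β hα hβ hαβ
      have h := controlPrimitive_combo hB hU.isBounded ⟨u, hu⟩ ⟨v, hv⟩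
        ⟨_, convex_lpControls hconv hu hv hα hβ hαβ⟩ rfl
      rw [hf ⟨u, hu⟩, hf ⟨v, hv⟩, hf ⟨_, convex_lpControls hconv hu hv hα hβ hαβ⟩, hf₀]
      simp only [h, map_add, map_smul]
  · obtain ⟨M, hM⟩ := norm_controlPrimitive_le hB hU.isBounded
    refine isBounded_iff_forall_norm_le.2 ⟨‖Λ‖ * M, ?_⟩
    rintro _ ⟨u, rfl⟩
    exact Λ.le_opNorm_of_le (hM u)

end Controls

/-! ### Reachable sets and the minimum time function -/

namespace ControlProblem

variable {n m : ℕ} {P : ControlProblem n m}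

/-- The reachable sets are compact. -/
theorem isCompact_reach (hP : P.StandingAssumptions) {t : ℝ} (ht : P.t₀ ≤ t) :
    IsCompact (P.reach t) := by
  have hA := hP.integrable_A t ht
  have hB := hP.integrable_B t ht
  have hUb := hP.isCompact_U.isBounded
  -- `Λ` solves the backward Volterra equation for a given right-hand side and evaluates the
  -- solution at `t₀`.
  let Λ : C(Icc P.t₀ t, RSpace n) →L[ℝ] RSpace n :=
    (ContinuousMap.evalCLM ℝ ⟨P.t₀, left_mem_Icc.2 ht⟩).comp
      (Ring.inverse (1 - volterra ht P.A hA))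
  have hreach : P.reach t = (fun z => Λ (ContinuousMap.const _ z)) '' P.S +
      range fun u : lpControls P.t₀ t P.U => Λ (controlPrimitive hB hUb u) := by
    ext x
    rw [Set.mem_add]
    constructor
    · rintro ⟨u, hu, y, hy, hyS⟩
      obtain ⟨R, hR⟩ := hUb.exists_norm_le
      have hbd : ∀ᵐ r ∂volume.restrict (Icc P.t₀ t), ‖u r‖ ≤ R :=
        (ae_restrict_mem measurableSet_Icc).mono fun r hr => hR _ (hu.2 r hr.1)
      have hmem : MemLp u 2 (volume.restrict (Icc P.t₀ t)) :=
        MemLp.of_bound hu.1.aestronglyMeasurable R hbd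
      have hw : hmem.toLp u ∈ lpControls P.t₀ t P.U := by
        filter_upwards [hmem.coeFn_toLp, ae_restrict_mem measurableSet_Icc] with r h1 h2
        rw [h1]
        exact hu.2 r h2.1
      have hg := integrableOn_clm_apply hB hu.1.aestronglyMeasurable hbd
      refine ⟨_, ⟨y t, hyS, rfl⟩, _, ⟨⟨_, hw⟩, rfl⟩, ?_⟩
      have hx := (exists_caratheodory_solution_iff ht hA hg x (y t)).1 ⟨y, hy, rfl⟩
      have hprim : controlPrimitive hB hUb ⟨_, hw⟩ = primitiveFromRight _ hg := by
        ext1 s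
        refine intervalIntegral.integral_congr_ae_restrict
          (ae_restrict_of_ae_restrict_of_subset
            (uIoc_subset_uIcc.trans (uIcc_subset_Icc (right_mem_Icc.2 ht) s.2)) ?_)
        filter_upwards [hmem.coeFn_toLp] with r h1
        rw [h1]
      simp only [← map_add, hprim]
      exact hx
    · rintro ⟨_, ⟨z, hz, rfl⟩, _, ⟨u, rfl⟩, rfl⟩
      obtain ⟨u₀, hu₀⟩ := hP.nonempty_U
      classical
      -- An `L²` control has values in `U` only almost everywhere on `[t₀, t]`. Resetting the other
      -- values to `u₀` makes it admissible and leaves the integrals unchanged.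
      let v : ℝ → RSpace m := fun r => if u.1 r ∈ P.U then u.1 r else u₀
      have hv : v ∈ P.admissible := by
        refine ⟨?_, fun r _ => ?_⟩
        · have hum := (Lp.stronglyMeasurable u.1).measurable
          exact Measurable.ite (hum hP.isCompact_U.measurableSet) hum measurable_const
        · simp only [v]
          split_ifs with h
          exacts [h, hu₀]
      have hvu : ∀ᵐ r ∂volume.restrict (Icc P.t₀ t), u.1 r = v r := by
        filter_upwards [u.2] with r hr
        simp only [v, if_pos hr]
      have hg : IntegrableOn (fun r => P.B r (v r)) (Icc P.t₀ t) := by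
        refine (integrableOn_clm_apply_lpControls hB hUb u.2).congr ?_
        filter_upwards [hvu] with r hr
        rw [hr]
      have hprim : controlPrimitive hB hUb u = primitiveFromRight _ hg := by
        ext1 s
        refine intervalIntegral.integral_congr_ae_restrict
          (ae_restrict_of_ae_restrict_of_subset
            (uIoc_subset_uIcc.trans (uIcc_subset_Icc (right_mem_Icc.2 ht) s.2)) ?_)
        filter_upwards [hvu] with r h1
        rw [h1]
      obtain ⟨y, hy, hyz⟩ := (exists_caratheodory_solution_iff ht hA hg _ z).2 rfl
      refine ⟨v, hv, y, ?_, hyz ▸ hz⟩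
      rw [← map_add, hprim]
      exact hy
  rw [hreach]
  refine IsCompact.add (hP.isCompact_S.image ?_)
    (isCompact_range_controlPrimitive hB hP.isCompact_U hP.convex_U Λ)
  exact Λ.continuous.comp ContinuousMap.continuous_const'

theorem t₀_le_minTime (x : RSpace n) : (P.t₀ : EReal) ≤ P.minTime x := by
  refine le_iInf₂ fun u _ => le_sInf ?_
  rintro _ ⟨t, ht, rfl⟩
  exact EReal.coe_le_coe_iff.2 ht.1

theorem minTime_le_of_mem_reach {x : RSpace n} {t : ℝ} (ht : P.t₀ ≤ t) (hx : x ∈ P.reach t) :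
    P.minTime x ≤ t := by
  obtain ⟨u, hu, hut⟩ := hx
  exact (iInf₂_le u hu).trans (sInf_le ⟨t, ⟨ht, hut⟩, rfl⟩)

theorem subset_reach_t₀ (hP : P.StandingAssumptions) : P.S ⊆ P.reach P.t₀ := by
  intro x hx
  obtain ⟨u₀, hu₀⟩ := hP.nonempty_U
  refine ⟨fun _ => u₀, ⟨measurable_const, fun _ _ => hu₀⟩, fun _ => x,
    ⟨continuousOn_const, fun s hs => ?_⟩, hx⟩
  rw [Icc_self, mem_singleton_iff] at hs
  simp [hs]

theorem minTime_eq_of_mem_target (hP : P.StandingAssumptions) {x : RSpace n} (hx : x ∈ P.S) :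
    P.minTime x = P.t₀ :=
  (minTime_le_of_mem_reach le_rfl (subset_reach_t₀ hP hx)).antisymm (t₀_le_minTime x)

/-- Nonemptiness keeps the Hausdorff distance to `P.reach t` from being the default value `0` of an
infinite distance. -/
theorem reach_nonempty (hP : P.StandingAssumptions) {t : ℝ} (ht : P.t₀ ≤ t) (htf : t ≤ P.tf) :
    (P.reach t).Nonempty := by
  have h0 := hP.nonempty_S.mono (subset_reach_t₀ hP)
  rcases ht.eq_or_lt with rfl | hlt
  · exact h0
  · exact h0.mono ((hP.strictly_expanding _ _ le_rfl hlt htf).trans interior_subset)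

/-- The minimum time function has the value `t` on the boundary of the reachable set `R(t)`. -/
theorem minTime_eq_of_mem_frontier_reach (hP : P.StandingAssumptions) {t : ℝ} (ht : P.t₀ ≤ t)
    (htf : t ≤ P.tf) {x : RSpace n} (hx : x ∈ frontier (P.reach t)) : P.minTime x = t := by
  refine (minTime_le_of_mem_reach ht
    ((isCompact_reach hP ht).isClosed.frontier_subset hx)).antisymm ?_
  refine le_iInf₂ fun u hu => le_sInf ?_
  rintro _ ⟨s, hs, rfl⟩
  refine EReal.coe_le_coe_iff.2 (not_lt.1 fun hst => hx.2 ?_)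
  exact hP.strictly_expanding s t hs.1 hst htf ⟨u, hu, hs.2⟩

end ControlProblem

/-! ### Boundary values of the discrete reachable sets -/

namespace DiscreteScheme

variable {n m : ℕ} {P : ControlProblem n m} (D : DiscreteScheme n m)

theorem t₀_le_time (hP : P.StandingAssumptions) (i : ℕ) : P.t₀ ≤ D.time P i :=
  le_add_of_nonneg_right (mul_nonneg i.cast_nonneg
    (div_nonneg (sub_nonneg.2 hP.t₀_lt_tf.le) D.K.cast_nonneg))

theorem time_le_tf (hP : P.StandingAssumptions) {i : ℕ} (hi : i ≤ D.K) : D.time P i ≤ P.tf := by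
  have hK : (0 : ℝ) < D.K := by exact_mod_cast D.K_pos
  have hiK : (i : ℝ) ≤ D.K := by exact_mod_cast hi
  have hdt : 0 ≤ D.dt P := div_nonneg (sub_nonneg.2 hP.t₀_lt_tf.le) hK.le
  have h1 : (D.K : ℝ) * D.dt P = P.tf - P.t₀ := mul_div_cancel₀ _ hK.ne'
  have h2 := mul_le_mul_of_nonneg_right hiK hdt
  rw [time]
  linarith

end DiscreteScheme

/-- A maximizer of a nonzero linear functional over a set is not an interior point. -/
theorem notMem_interior_of_forall_inner_le {E : Type*} [NormedAddCommGroup E]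
    [InnerProductSpace ℝ E] {A : Set E} {l x : E} (hl : ‖l‖ = 1)
    (h : ∀ a ∈ A, inner ℝ l a ≤ inner ℝ l x) : x ∉ interior A := by
  intro hx
  have hcont : Filter.Tendsto (fun r : ℝ => x + r • l) (nhds 0) (nhds x) := by
    have : Continuous fun r : ℝ => x + r • l := by fun_prop
    simpa using this.tendsto 0
  obtain ⟨δ, hδ, hball⟩ :=
    Metric.eventually_nhds_iff.1 (hcont.eventually (mem_interior_iff_mem_nhds.1 hx))
  have hmem : x + (δ / 2) • l ∈ A := hball (by
    rw [dist_zero_right, Real.norm_of_nonneg (half_pos hδ).le]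
    exact half_lt_self hδ)
  have := h _ hmem
  rw [inner_add_right, real_inner_smul_right, real_inner_self_eq_norm_sq, hl] at this
  linarith

namespace AlgorithmRun

variable {n m : ℕ} {P : ControlProblem n m} {D : DiscreteScheme n m} (Z : AlgorithmRun P D)

theorem isCompact_R (i : ℕ) : IsCompact (Z.R i) :=
  (finite_range (Z.y i)).isCompact_convexHull ℝ

theorem R_subset_Ω {i : ℕ} (hi : i ≤ D.K) : Z.R i ⊆ Z.Ω :=
  subset_biUnion_of_mem (u := Z.R) (mem_Iic.2 hi)

theorem R_zero_subset_target (hP : P.StandingAssumptions) : Z.R 0 ⊆ P.S := by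
  refine convexHull_min ?_ hP.convex_S
  rintro _ ⟨k, rfl⟩
  exact (Z.y_zero k).1

/-- The supporting points computed by the algorithm are boundary points. -/
theorem mem_frontier_of_mem_Y {i : ℕ} (hi : i < D.K) {x : RSpace n} (hx : x ∈ Z.Y (i + 1)) :
    x ∈ frontier (Z.R (i + 1)) := by
  obtain ⟨k, rfl⟩ := hx
  refine ⟨subset_closure (subset_convexHull ℝ _ ⟨k, rfl⟩),
    notMem_interior_of_forall_inner_le (D.norm_dirR k) fun a ha => (Z.y_succ i hi k).2 a ?_⟩
  -- The supporting point is maximal over the hull of the whole Minkowski sum, which contains `Z.R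
  -- (i + 1)`.
  refine convexHull_min ?_ (convex_convexHull ℝ _) ha
  rintro _ ⟨κ, rfl⟩
  exact (Z.y_succ i hi κ).1

/-- On the boundary of a discrete reachable set `R_{hΔ}(tᵢ)`, the minimum time function differs
from `tᵢ` by at most the modulus at the Hausdorff distance bound. -/
theorem abs_minTime_sub_time_le (hP : P.StandingAssumptions) {ω : ℝ → ℝ}
    (hω_mono : MonotoneOn ω (Ici 0))
    (hω : ∀ x ∈ P.reachAll, ∀ y ∈ P.reachAll,
      |(P.minTime x).toReal - (P.minTime y).toReal| ≤ ω ‖x - y‖)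
    (hΩ : Z.Ω ⊆ P.reachAll) {i : ℕ} (hi : i ≤ D.K) {ε : ℝ}
    (hε : Metric.hausdorffDist (Z.R i) (P.reach (D.time P i)) ≤ ε) {x : RSpace n}
    (hx : x ∈ frontier (Z.R i)) : |(P.minTime x).toReal - D.time P i| ≤ ω ε := by
  have ht := D.t₀_le_time hP i
  have htf := D.time_le_tf hP hi
  have hcomp := ControlProblem.isCompact_reach hP ht
  obtain ⟨z, hz, hxz⟩ := exists_mem_frontier_dist_le_hausdorffDist (Z.isCompact_R i)
    (convex_convexHull ℝ _) hcomp (ControlProblem.reach_nonempty hP ht htf) hx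
  have hzT := ControlProblem.minTime_eq_of_mem_frontier_reach hP ht htf hz
  have hxΩ := hΩ (Z.R_subset_Ω hi ((Z.isCompact_R i).isClosed.frontier_subset hx))
  have hzR : z ∈ P.reachAll :=
    mem_biUnion (t := P.reach) (mem_Ici.2 ht) (hcomp.isClosed.frontier_subset hz)
  have h := hω x hxΩ z hzR
  rw [hzT, EReal.toReal_coe] at h
  rw [dist_eq_norm] at hxz
  exact h.trans (hω_mono (norm_nonneg _) ((norm_nonneg _).trans (hxz.trans hε)) (hxz.trans hε))

end AlgorithmRun

/-! ### Interpolation on the simplices and the error estimate -/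

theorem Triangulation.dist_le_maxDiam {n m : ℕ} {P : ControlProblem n m} {D : DiscreteScheme n m}
    {Z : AlgorithmRun P D} (G : Triangulation Z) {j : Fin G.M} {x y : RSpace n}
    (hx : x ∈ G.cell j) (hy : y ∈ G.cell j) : dist x y ≤ G.maxDiam :=
  (Metric.dist_le_diam_of_mem ((finite_range _).isCompact_convexHull ℝ).isBounded hx hy).trans
    (le_ciSup (f := fun j => Metric.diam (G.cell j)) (finite_range _).bddAbove j)

/-- A convex combination is within `δ` of `t` if the combined numbers are. -/
theorem abs_sub_sum_mul_le {ι : Type*} [Fintype ι] {w f : ι → ℝ} {t δ : ℝ} (hw : ∀ i, 0 ≤ w i)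
    (hw1 : ∑ i, w i = 1) (hf : ∀ i, |t - f i| ≤ δ) : |t - ∑ i, w i * f i| ≤ δ := by
  have h : t - ∑ i, w i * f i = ∑ i, w i * (t - f i) := by
    simp only [mul_sub, Finset.sum_sub_distrib, ← Finset.sum_mul, hw1, one_mul]
  rw [h]
  calc |∑ i, w i * (t - f i)| ≤ ∑ i, |w i * (t - f i)| := Finset.abs_sum_le_sum_abs _ _
    _ ≤ ∑ i, w i * δ := Finset.sum_le_sum fun i _ => by
        rw [abs_mul, abs_of_nonneg (hw i)]
        exact mul_le_mul_of_nonneg_left (hf i) (hw i)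
    _ = δ := by rw [← Finset.sum_mul, hw1, one_mul]

theorem exists_weights_of_mem_convexHull_range {ι E : Type*} [Fintype ι] [AddCommGroup E]
    [Module ℝ E] {v : ι → E} {x : E} (hx : x ∈ convexHull ℝ (range v)) :
    ∃ w : ι → ℝ, (∀ i, 0 ≤ w i) ∧ ∑ i, w i = 1 ∧ ∑ i, w i • v i = x := by
  classical
  rw [convexHull_range_eq_exists_affineCombination] at hx
  obtain ⟨s, w, hw, hw1, rfl⟩ := hx
  refine ⟨fun i => if i ∈ s then w i else 0, fun i => ?_, ?_, ?_⟩
  · dsimp only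
    split_ifs with h
    exacts [hw i h, le_rfl]
  · simpa using hw1
  · simp [ite_smul, s.affineCombination_eq_linear_combination v w hw1]

theorem theorem3p4 {n m : ℕ} (P : ControlProblem n m) (hP : P.StandingAssumptions)
    (ω : ℝ → ℝ) (hω_mono : MonotoneOn ω (Set.Ici 0))
    (hω : ∀ x ∈ P.reachAll, ∀ y ∈ P.reachAll,
      |(P.minTime x).toReal - (P.minTime y).toReal| ≤ ω ‖x - y‖)
    (D : DiscreteScheme n m) (Z : AlgorithmRun P D) (G : Triangulation Z)
    (hΩ : Z.Ω ⊆ P.reachAll)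
    (C p : ℝ)
    (hC : ∀ i ≤ D.K, Metric.hausdorffDist (Z.R i) (P.reach (D.time P i)) ≤ C * (D.h P) ^ p)
    (T_hΔ : RSpace n → ℝ) (hT : IsDiscreteMinTime G T_hΔ) :
    supNormOn Z.Ω (fun x => (P.minTime x).toReal - T_hΔ x) ≤
      ENNReal.ofReal (ω G.maxDiam + ω (C * (D.h P) ^ p)) := by
  refine iSup₂_le fun x hxΩ => ?_
  rw [← ofReal_norm, Real.norm_eq_abs]
  refine ENNReal.ofReal_le_ofReal ?_
  beta_reduce
  set ε := C * (D.h P) ^ p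
  -- No sign is assumed for `C` or `ω`: the Hausdorff distance forces `ε ≥ 0`, and the modulus at `x
  -- = y` forces `ω 0 ≥ 0`.
  have hε : 0 ≤ ε := Metric.hausdorffDist_nonneg.trans (hC 0 D.K.zero_le)
  have hω0 : 0 ≤ ω 0 := by simpa using hω x (hΩ hxΩ) x (hΩ hxΩ)
  have hω_nonneg : ∀ s, 0 ≤ s → 0 ≤ ω s := fun s hs =>
    hω0.trans (hω_mono self_mem_Ici (mem_Ici.2 hs) hs)
  have hωd : 0 ≤ ω G.maxDiam := hω_nonneg _ (Real.iSup_nonneg fun _ => Metric.diam_nonneg)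
  have htarget : ∀ z ∈ P.S, (P.minTime z).toReal = P.t₀ := fun z hz => by
    rw [ControlProblem.minTime_eq_of_mem_target hP hz, EReal.toReal_coe]
  have hR0 : ∀ z ∈ Z.R 0, |(P.minTime z).toReal - T_hΔ z| ≤ ω ε := fun z hz => by
    rw [hT.on_target z hz, htarget z (Z.R_zero_subset_target hP hz), sub_self, abs_zero]
    exact hω_nonneg ε hε
  have hbdry : ∀ z ∉ Z.R 0, Z.OnBoundary z → |(P.minTime z).toReal - T_hΔ z| ≤ ω ε := by
    intro z hz hzb
    obtain ⟨i, -, hi, hzi, hTz⟩ := hT.on_boundary z hz hzb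
    rw [hTz]
    exact Z.abs_minTime_sub_time_le hP hω_mono hω hΩ hi (hC i hi) hzi
  by_cases hx0 : x ∈ Z.R 0
  · linarith [hR0 x hx0]
  by_cases hxb : Z.OnBoundary x
  · linarith [hbdry x hx0 hxb]
  by_cases hxc : ∃ j, x ∈ G.cell j
  · obtain ⟨j, hj⟩ := hxc
    obtain ⟨w, hw, hw1, hwx⟩ := exists_weights_of_mem_convexHull_range hj
    rw [hT.on_simplex x hxΩ hx0 hxb j w hw hw1 hwx.symm]
    -- It suffices to compare `T x` with each vertex value of `T_hΔ`, passing through `T` at the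
    -- vertex.
    refine abs_sub_sum_mul_le hw hw1 fun ν => ?_
    set z := (G.simplex j).points ν
    have hzc : z ∈ G.cell j := subset_convexHull ℝ _ ⟨ν, rfl⟩
    obtain ⟨i, hi, hzi⟩ := G.nodes j ν
    have hzΩ : z ∈ Z.Ω := Z.R_subset_Ω hi (subset_convexHull ℝ _ hzi)
    have h1 : |(P.minTime x).toReal - (P.minTime z).toReal| ≤ ω G.maxDiam := by
      have hd := G.dist_le_maxDiam hj hzc
      rw [dist_eq_norm] at hd
      exact (hω x (hΩ hxΩ) z (hΩ hzΩ)).trans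
        (hω_mono (norm_nonneg _) ((norm_nonneg _).trans hd) hd)
    have h2 : |(P.minTime z).toReal - T_hΔ z| ≤ ω ε := by
      by_cases hz0 : z ∈ Z.R 0
      · exact hR0 z hz0
      · refine hbdry z hz0 ?_
        -- `OnBoundary` starts at index `1`; nodes of index `0` lie in `Z.R 0`, which is excluded
        -- here.
        cases i with
        | zero => exact absurd (subset_convexHull ℝ _ hzi) hz0
        | succ i =>
          exact ⟨i + 1, Nat.le_add_left 1 i, hi, Z.mem_frontier_of_mem_Y (Nat.lt_of_succ_le hi) hzi⟩
    exact (abs_sub_le _ _ _).trans (add_le_add h1 h2)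
  · have hxc' : ∀ j, x ∉ G.cell j := not_exists.1 hxc
    have hxS : x ∈ P.S := by
      by_contra hxS
      obtain ⟨j, hj⟩ := mem_iUnion.1 (G.covers ⟨hxΩ, fun h => hxS (interior_subset h)⟩)
      exact hxc' j hj
    rw [hT.on_rest x hxΩ hx0 hxb hxS hxc', htarget x hxS, sub_self, abs_zero]
    exact add_nonneg hωd (hω_nonneg ε hε)
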